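/- Let $t$ be a real number with $t \neq 0$, and consider sequences $(a_n)_{n\ge -1}$ of real numbers satisfying $a_{-1}=-1$ and the discrete Painlevé II equation \[ a_{n+1}+a_{n-1} = \frac{-2(n+1)a_n}{t(1-a_n^2)}, \qquad n \ge 0, \] where $1-a_n^2\neq 0$ for all $n\ge 0$. There is exactly one such sequence for which $-1<a_n<1$ for all $n\ge 0$. It is the solution obtained by taking $a_0 = I_1(t)/I_0(t)$, where $I_n(t)=\sum_{k\ge 0}\frac{(t/2)^{2k+n}}{k!\,(k+n)!}$ is the modified Bessel function of order $n$, and $I_0(t)\neq 0$. Moreover, $(a_n)_{n\ge 0}$ are the Verblunsky coefficients of the weight $e^{t\cos\theta}$ on the unit circle, i.e. $a_n=-\overline{\Phi_{n+1}(0)}$ for all $n \geq 0$, where $\Phi_n$ is the monic polynomial of degree $n$ and, for some constants $\kappa_n>0$, \[ \int_0^{2\pi} \Phi_n(e^{i\theta})\,\overline{\Phi_m(e^{i\theta})}\, e^{t\cos\theta}\,d\theta = \frac{\delta_{m,n}}{\kappa_n^2}, \qquad m,n\ge 0. \] -/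

import Mathlib

open scoped Nat ComplexConjugate

/-- The modified Bessel function of the first kind `I_n(t)`, of order `n = 0, 1, 2, …`. -/
noncomputable def besselI (n : ℕ) (t : ℝ) : ℝ :=
  ∑' k : ℕ, (t / 2) ^ (2 * k + n) / ((k ! : ℝ) * ((k + n)! : ℝ))

/-- `(a_n)_{n ≥ -1}` is a solution of the discrete Painlevé II equation with `a_{-1} = -1`.
Only the values at indices `n ≥ -1` matter; the right-hand side must make sense for each `n ≥ 0`. -/
def IsDPIISolution (t : ℝ) (a : ℤ → ℝ) : Prop :=
  a (-1) = -1 ∧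
    ∀ n : ℤ, 0 ≤ n →
      1 - a n ^ 2 ≠ 0 ∧
        a (n + 1) + a (n - 1) = -2 * ((n : ℝ) + 1) * a n / (t * (1 - a n ^ 2))

/-- `Φ_0, Φ_1, …` are the monic orthogonal polynomials on the unit circle for the weight `w(θ)`,
`0 ≤ θ ≤ 2π`: `Φ_n` is monic of degree `n`, and the integral of `Φ_n(z) * conj Φ_m(z) * w(θ)`,
with `z = e^{iθ}`, is `1 / κ_n ^ 2` with `κ_n > 0` when `m = n`, and `0` otherwise. -/
def IsMonicOPUC (w : ℝ → ℝ) (Φ : ℕ → Polynomial ℂ) : Prop :=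
  (∀ n, (Φ n).Monic ∧ (Φ n).natDegree = n) ∧
    ∃ κ : ℕ → ℝ, (∀ n, 0 < κ n) ∧
      ∀ m n : ℕ,
        ∫ θ in (0 : ℝ)..2 * Real.pi,
            (Φ n).eval (Complex.exp (θ * Complex.I)) *
              conj ((Φ m).eval (Complex.exp (θ * Complex.I))) * (w θ : ℂ) =
          if m = n then 1 / (κ n : ℂ) ^ 2 else 0

/-- `α_0, α_1, …` are the Verblunsky coefficients of the weight `w`:
`α_n` is `- conj Φ_{n+1}(0)`, with `Φ_n` the monic orthogonal polynomials for `w`. -/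
def IsVerblunskySequence (w : ℝ → ℝ) (α : ℕ → ℂ) : Prop :=
  ∃ Φ : ℕ → Polynomial ℂ, IsMonicOPUC w Φ ∧ ∀ n, α n = -conj ((Φ (n + 1)).eval 0)

/-!
The link between the weight `e^{t cos θ}` and discrete Painlevé II is carried by a purely algebraic
Toeplitz form `⟨X ^ i, X ^ j⟩ = c (i - j)` on `ℝ[X]`, where `c` is even and satisfies the Bessel
recurrence `k c_k = (t / 2) (c_{k-1} - c_{k+1})`. That recurrence says that the Euler operator
`X d/dX` is symmetric up to multiplication by the logarithmic derivative of the weight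
(`toeplitzForm_euler`). If Szegő's recursion with coefficients `a_n` produces orthogonal
polynomials for the form, then expanding `⟨X Φ_{m+1}', Φ_m^*⟩` in two ways gives the string equation
`szegoPair_string`, which is discrete Painlevé II for `a_n`.

Existence: the cosine moments of `e^{t cos θ}` satisfy the Bessel recurrence by integration by
parts, and their form is positive definite since it is the `L²` pairing on the circle
(`integral_map_eval_mul_conj`). So the Verblunsky coefficients exist, lie in `(-1, 1)` and solve
discrete Painlevé II.

Uniqueness: let `b` be any solution in `(-1, 1)`, and let `c` be the solution of the Bessel
recurrence with `c_0 = 1`, `c_1 = b_0`. Read backwards, the string equation shows that `b` is the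
Verblunsky sequence of `c` (`IsDPIISolution.isVerblunskyAt`). As `|b_n| < 1`, the form of `c` is
positive, so `|c_n| ≤ c_0`. The recurrence has the solution `I_n(t)`, which tends to `0`, and
the Wronskian of two solutions has constant modulus; hence the bounded solution `c` is a multiple of
`I_n(t)` (`bessel_recurrence_wronskian`) and `b_0 = I_1(t) / I_0(t)`. The recursion then determines
`b`. The same Wronskian lemma, applied to the moments of the weight, evaluates `a_0` without
expanding any integral in a series.
-/

section
open Polynomial

/-! ### Toeplitz forms on real polynomials -/

/-- The bilinear form on `ℝ[X]` with the Toeplitz Gram matrix `⟨X ^ i, X ^ j⟩ = c (i - j)`. -/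
noncomputable def toeplitzForm (c : ℤ → ℝ) : ℝ[X] →ₗ[ℝ] ℝ[X] →ₗ[ℝ] ℝ :=
  Polynomial.lsum fun i => LinearMap.toSpanSingleton ℝ (ℝ[X] →ₗ[ℝ] ℝ)
    (Polynomial.lsum fun j => c ((i : ℤ) - j) • LinearMap.id)

lemma toeplitzForm_monomial (c : ℤ → ℝ) (i j : ℕ) (x y : ℝ) :
    toeplitzForm c (monomial i x) (monomial j y) = x * y * c ((i : ℤ) - j) := by
  simp [toeplitzForm, Polynomial.lsum_apply, Polynomial.sum_monomial_index]
  ring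

lemma toeplitzForm_X_pow (c : ℤ → ℝ) (i j : ℕ) :
    toeplitzForm c (X ^ i) (X ^ j) = c ((i : ℤ) - j) := by
  rw [← monomial_one_right_eq_X_pow, ← monomial_one_right_eq_X_pow, toeplitzForm_monomial]
  simp

/-- Two bilinear expressions in a pair of polynomials agree once they agree on monomials. -/
lemma bilinear_eq_of_monomial {M : Type*} [AddCommGroup M] [Module ℝ M]
    {F G : ℝ[X] →ₗ[ℝ] ℝ[X] →ₗ[ℝ] M}
    (h : ∀ i j : ℕ, F (X ^ i) (X ^ j) = G (X ^ i) (X ^ j)) : F = G := by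
  ext i j
  simpa [monomial_one_right_eq_X_pow] using h i j

lemma toeplitzForm_comm {c : ℤ → ℝ} (hc : ∀ k, c (-k) = c k) (p q : ℝ[X]) :
    toeplitzForm c p q = toeplitzForm c q p := by
  have h : toeplitzForm c = (toeplitzForm c).flip := bilinear_eq_of_monomial fun i j => by
    rw [LinearMap.flip_apply, toeplitzForm_X_pow, toeplitzForm_X_pow, ← hc]
    congr 1
    ring
  exact LinearMap.congr_fun₂ h p q

lemma toeplitzForm_X_mul_X_mul (c : ℤ → ℝ) (p q : ℝ[X]) :
    toeplitzForm c (X * p) (X * q) = toeplitzForm c p q := by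
  have h : (toeplitzForm c).compl₁₂ (LinearMap.mulLeft ℝ X) (LinearMap.mulLeft ℝ X) =
      toeplitzForm c := bilinear_eq_of_monomial fun i j => by
    simp only [LinearMap.compl₁₂_apply, LinearMap.mulLeft_apply, ← pow_succ', toeplitzForm_X_pow]
    congr 1
    push_cast
    ring
  exact LinearMap.congr_fun₂ h p q

lemma toeplitzForm_X_mul_X_pow_succ (c : ℤ → ℝ) (p : ℝ[X]) (k : ℕ) :
    toeplitzForm c (X * p) (X ^ (k + 1)) = toeplitzForm c p (X ^ k) := by
  rw [pow_succ', toeplitzForm_X_mul_X_mul]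

/-- Integration by parts for a Toeplitz form whose moments satisfy the Bessel recurrence: up to
the weight's logarithmic derivative, the Euler operator `X d/dX` is symmetric. -/
lemma toeplitzForm_euler {c : ℤ → ℝ} {t : ℝ}
    (hrec : ∀ k : ℤ, (k : ℝ) * c k = t / 2 * (c (k - 1) - c (k + 1))) (p q : ℝ[X]) :
    toeplitzForm c (X * derivative p) q - toeplitzForm c p (X * derivative q) =
      t / 2 * (toeplitzForm c p (X * q) - toeplitzForm c (X * p) q) := by
  have h : (toeplitzForm c).compl₁₂ ((LinearMap.mulLeft ℝ X) ∘ₗ derivative) LinearMap.id -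
      (toeplitzForm c).compl₁₂ LinearMap.id ((LinearMap.mulLeft ℝ X) ∘ₗ derivative) =
      (t / 2) • ((toeplitzForm c).compl₁₂ LinearMap.id (LinearMap.mulLeft ℝ X) -
        (toeplitzForm c).compl₁₂ (LinearMap.mulLeft ℝ X) LinearMap.id) :=
    bilinear_eq_of_monomial fun i j => by
      have hD : ∀ i : ℕ, X * derivative (X ^ i : ℝ[X]) = (i : ℝ) • X ^ i := by
        intro i
        cases i with
        | zero => simp
        | succ i =>
          rw [derivative_X_pow, smul_eq_C_mul, Nat.add_sub_cancel, pow_succ']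
          ring
      simp only [LinearMap.compl₁₂_apply, LinearMap.mulLeft_apply, LinearMap.sub_apply,
        LinearMap.smul_apply, LinearMap.comp_apply, LinearMap.id_apply, hD, map_smul,
        ← pow_succ', toeplitzForm_X_pow, smul_eq_mul]
      have := hrec ((i : ℤ) - j)
      push_cast at this ⊢
      rw [show (i : ℤ) - (j + 1) = i - j - 1 by ring, show (i : ℤ) + 1 - j = i - j + 1 by ring]
      linarith
  exact LinearMap.congr_fun₂ h p q

lemma toeplitzForm_eq_sum (c : ℤ → ℝ) (p : ℝ[X]) {q : ℝ[X]} {N : ℕ} (hq : q.natDegree ≤ N) :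
    toeplitzForm c p q = ∑ i ∈ Finset.range (N + 1), q.coeff i * toeplitzForm c p (X ^ i) := by
  conv_lhs => rw [q.as_sum_range' (N + 1) (by omega)]
  simp [← C_mul_X_pow_eq_monomial, ← smul_eq_C_mul]

/-- A form value `⟨p, q⟩` when `p` is orthogonal to `X ^ k`, `k < n`, and `deg q ≤ n`. -/
lemma toeplitzForm_eq_coeff_mul {c : ℤ → ℝ} {p q : ℝ[X]} {n : ℕ}
    (hp : ∀ k < n, toeplitzForm c p (X ^ k) = 0) (hq : q.natDegree ≤ n) :
    toeplitzForm c p q = q.coeff n * toeplitzForm c p (X ^ n) := by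
  rw [toeplitzForm_eq_sum c p hq, Finset.sum_range_succ, Finset.sum_eq_zero, zero_add]
  intro i hi
  rw [hp i (Finset.mem_range.1 hi), mul_zero]

/-! ### Szegő recursion -/

/-- The pair `(Φ_n, Φ_n^*)` of real polynomials generated by Szegő's recursion
`Φ_{n+1} = X Φ_n - a_n Φ_n^*`, `Φ_{n+1}^* = Φ_n^* - a_n X Φ_n`, from `Φ_0 = Φ_0^* = 1`. -/
noncomputable def szegoPair (a : ℕ → ℝ) : ℕ → ℝ[X] × ℝ[X]
  | 0 => (1, 1)
  | n + 1 => (X * (szegoPair a n).1 - a n • (szegoPair a n).2,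
      (szegoPair a n).2 - a n • (X * (szegoPair a n).1))

variable (a : ℕ → ℝ)

lemma szegoPair_natDegree (n : ℕ) :
    (szegoPair a n).1.natDegree ≤ n ∧ (szegoPair a n).2.natDegree ≤ n := by
  induction n with
  | zero => simp [szegoPair]
  | succ n ih =>
    have hX : (X * (szegoPair a n).1).natDegree ≤ n + 1 :=
      natDegree_mul_le.trans (by have := natDegree_X_le (R := ℝ); omega)
    have h2 : (szegoPair a n).2.natDegree ≤ n + 1 := ih.2.trans n.le_succ
    exact ⟨(natDegree_sub_le_of_le hX ((natDegree_smul_le (a n) _).trans h2)).trans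
        (max_self _).le,
      (natDegree_sub_le_of_le h2 ((natDegree_smul_le (a n) _).trans hX)).trans (max_self _).le⟩

lemma szegoPair_coeff_top (n : ℕ) :
    (szegoPair a n).1.coeff n = 1 ∧ (szegoPair a n).2.coeff 0 = 1 := by
  induction n with
  | zero => simp [szegoPair]
  | succ n ih =>
    have h2 : (szegoPair a n).2.coeff (n + 1) = 0 :=
      coeff_eq_zero_of_natDegree_lt (by have := (szegoPair_natDegree a n).2; omega)
    simp [szegoPair, h2, ih, coeff_X_mul]

lemma szegoPair_coeff_zero_succ (n : ℕ) : (szegoPair a (n + 1)).1.coeff 0 = -a n := by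
  simp [szegoPair, (szegoPair_coeff_top a n).2]

lemma szegoPair_snd_coeff_top (n : ℕ) :
    (szegoPair a n).2.coeff n = (szegoPair a n).1.coeff 0 := by
  cases n with
  | zero => simp [szegoPair]
  | succ n =>
    have h2 : (szegoPair a n).2.coeff (n + 1) = 0 :=
      coeff_eq_zero_of_natDegree_lt (by have := (szegoPair_natDegree a n).2; omega)
    rw [szegoPair_coeff_zero_succ]
    simp [szegoPair, h2, (szegoPair_coeff_top a n).1, coeff_X_mul]

lemma szegoPair_monic (n : ℕ) : (szegoPair a n).1.Monic :=
  monic_of_natDegree_le_of_coeff_eq_one n (szegoPair_natDegree a n).1 (szegoPair_coeff_top a n).1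

lemma szegoPair_natDegree_eq (n : ℕ) : (szegoPair a n).1.natDegree = n :=
  natDegree_eq_of_le_of_coeff_ne_zero (szegoPair_natDegree a n).1
    (by rw [(szegoPair_coeff_top a n).1]; exact one_ne_zero)

/-- For an even moment sequence, reversal of coefficients exchanges `Φ_n` and `Φ_n^*` in the
moments. The powers `m`, `m'` of `X` stand for negative exponents on the other side. -/
lemma toeplitzForm_szegoPair_reverse {c : ℤ → ℝ} (hc : ∀ k, c (-k) = c k) (n : ℕ) :
    ∀ k l m m' : ℕ, k + l = n + m + m' →
      toeplitzForm c (X ^ m * (szegoPair a n).2) (X ^ k) =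
        toeplitzForm c (X ^ m' * (szegoPair a n).1) (X ^ l) := by
  induction n with
  | zero =>
    intro k l m m' h
    simp only [szegoPair, mul_one, toeplitzForm_X_pow]
    rw [← hc]
    congr 1
    omega
  | succ n ih =>
    intro k l m m' h
    have h1 := ih k l m (m' + 1) (by omega)
    have h2 := ih l k m' (m + 1) (by omega)
    simp only [szegoPair, mul_sub, mul_smul_comm, map_sub, map_smul, LinearMap.sub_apply,
      LinearMap.smul_apply, ← mul_assoc, ← pow_succ, h1, h2]

lemma toeplitzForm_szegoPair_snd_X_pow_succ {c : ℤ → ℝ} (hc : ∀ k, c (-k) = c k) (n : ℕ) :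
    toeplitzForm c (szegoPair a n).2 (X ^ (n + 1)) =
      toeplitzForm c (X * (szegoPair a n).1) 1 := by
  simpa using toeplitzForm_szegoPair_reverse a hc n (n + 1) 0 0 1 (by omega)

/-! ### Orthogonality -/

/-- `a` has the Verblunsky property for the Toeplitz form of `c` at index `k`: the choice of `a k`
makes `Φ_{k+1}` orthogonal to `1`. -/
def IsVerblunskyAt (c : ℤ → ℝ) (a : ℕ → ℝ) (k : ℕ) : Prop :=
  toeplitzForm c (X * (szegoPair a k).1) 1 = a k * toeplitzForm c (szegoPair a k).2 1

variable {a}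

lemma szegoPair_orthogonal {c : ℤ → ℝ} (hc : ∀ k, c (-k) = c k) {n : ℕ}
    (h : ∀ k < n, IsVerblunskyAt c a k) :
    (∀ k < n, toeplitzForm c (szegoPair a n).1 (X ^ k) = 0) ∧
      (∀ k < n, toeplitzForm c (szegoPair a n).2 (X ^ (k + 1)) = 0) := by
  induction n with
  | zero => simp
  | succ n ih =>
    obtain ⟨h1, h2⟩ := ih fun k hk => h k (by omega)
    have hv : toeplitzForm c (X * (szegoPair a n).1) 1 =
      a n * toeplitzForm c (szegoPair a n).2 1 := h n (by omega)
    constructor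
    · intro k hk
      cases k with
      | zero => simp [szegoPair, hv]
      | succ k =>
        simp [szegoPair, toeplitzForm_X_mul_X_pow_succ, h1 k (by omega), h2 k (by omega)]
    · intro k hk
      rcases Nat.lt_succ_iff_lt_or_eq.1 hk with hk | rfl
      · simp [szegoPair, toeplitzForm_X_mul_X_pow_succ, h1 k hk, h2 k hk]
      · have h0 := toeplitzForm_szegoPair_reverse a hc k 0 k 0 0 (by omega)
        simp only [pow_zero, one_mul] at h0
        simp [szegoPair, toeplitzForm_X_mul_X_pow_succ,
          toeplitzForm_szegoPair_snd_X_pow_succ a hc, hv, ← h0]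

lemma toeplitzForm_szegoPair_fst_X_pow {c : ℤ → ℝ} (hc : ∀ k, c (-k) = c k) (n : ℕ) :
    toeplitzForm c (szegoPair a n).1 (X ^ n) = toeplitzForm c (szegoPair a n).2 1 := by
  simpa using (toeplitzForm_szegoPair_reverse a hc n 0 n 0 0 (by omega)).symm

lemma szegoPair_norm_succ {c : ℤ → ℝ} {n : ℕ} (h : IsVerblunskyAt c a n) :
    toeplitzForm c (szegoPair a (n + 1)).2 1 =
      (1 - a n ^ 2) * toeplitzForm c (szegoPair a n).2 1 := by
  unfold IsVerblunskyAt at h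
  simp [szegoPair, h]
  ring

lemma toeplitzForm_szegoPair_self {c : ℤ → ℝ} (hc : ∀ k, c (-k) = c k) {n : ℕ}
    (h : ∀ k < n, IsVerblunskyAt c a k) :
    toeplitzForm c (szegoPair a n).1 (szegoPair a n).1 = toeplitzForm c (szegoPair a n).2 1 := by
  rw [toeplitzForm_eq_coeff_mul (szegoPair_orthogonal hc h).1 (szegoPair_natDegree a n).1,
    (szegoPair_coeff_top a n).1, one_mul, toeplitzForm_szegoPair_fst_X_pow hc]

/-- The string equation. It is integration by parts for `⟨Φ_{m+1}, Φ_m^*⟩`, each term of which is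
a single moment by orthogonality. -/
lemma szegoPair_string {c : ℤ → ℝ} {t : ℝ} (hc : ∀ k, c (-k) = c k)
    (hrec : ∀ k : ℤ, (k : ℝ) * c k = t / 2 * (c (k - 1) - c (k + 1))) {m : ℕ}
    (h : ∀ k < m + 1, IsVerblunskyAt c a k) :
    ((m : ℝ) + 1) * toeplitzForm c (X * (szegoPair a m).1) 1 =
      t / 2 * ((szegoPair a m).1.coeff 0 * toeplitzForm c (szegoPair a (m + 1)).2 1 -
        toeplitzForm c (X * (szegoPair a (m + 1)).1) 1) := by
  have hm := szegoPair_orthogonal hc fun k hk => h k (Nat.lt_succ_of_lt hk)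
  have hm1 := szegoPair_orthogonal hc h
  have key := toeplitzForm_euler hrec (szegoPair a (m + 1)).1 (szegoPair a m).2
  have dX : ∀ (p : ℝ[X]) (N : ℕ), p.natDegree ≤ N → (X * derivative p).natDegree ≤ N := by
    intro p N hp
    rcases Nat.eq_zero_or_pos p.natDegree with h0 | h0
    · rw [derivative_of_natDegree_zero h0]; simp
    · have := natDegree_derivative_lt h0.ne'
      have := natDegree_X_le (R := ℝ)
      exact natDegree_mul_le.trans (by omega)
  -- `X Φ_{m+1}'` has no constant term, and `Φ_m^*` is orthogonal to `X, …, X ^ m`, so only the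
  -- leading term `(m + 1) X ^ (m + 1)` contributes.
  have T1 : toeplitzForm c (X * derivative (szegoPair a (m + 1)).1) (szegoPair a m).2 =
      ((m : ℝ) + 1) * toeplitzForm c (X * (szegoPair a m).1) 1 := by
    rw [toeplitzForm_comm hc, toeplitzForm_eq_sum c _ (dX _ _ (szegoPair_natDegree a (m + 1)).1),
      Finset.sum_range_succ, Finset.sum_range_succ', Finset.sum_eq_zero,
      toeplitzForm_szegoPair_snd_X_pow_succ a hc, coeff_X_mul, coeff_derivative,
      (szegoPair_coeff_top a (m + 1)).1]
    · simp
    · intro i hi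
      rw [hm.2 i (Finset.mem_range.1 hi), mul_zero]
  have T2 : toeplitzForm c (szegoPair a (m + 1)).1 (X * derivative (szegoPair a m).2) = 0 := by
    have hd := dX _ _ (szegoPair_natDegree a m).2
    rw [toeplitzForm_eq_coeff_mul hm1.1 (hd.trans (Nat.le_succ m)),
      coeff_eq_zero_of_natDegree_lt (by omega), zero_mul]
  have T3 : toeplitzForm c (szegoPair a (m + 1)).1 (X * (szegoPair a m).2) =
      (szegoPair a m).1.coeff 0 * toeplitzForm c (szegoPair a (m + 1)).2 1 := by
    have hd := (szegoPair_natDegree a m).2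
    have := natDegree_X_le (R := ℝ)
    rw [toeplitzForm_eq_coeff_mul hm1.1 (natDegree_mul_le.trans (by omega)), coeff_X_mul,
      szegoPair_snd_coeff_top, toeplitzForm_szegoPair_fst_X_pow hc]
  have T4 : toeplitzForm c (X * (szegoPair a (m + 1)).1) (szegoPair a m).2 =
      toeplitzForm c (X * (szegoPair a (m + 1)).1) 1 := by
    rw [toeplitzForm_eq_sum c _ (szegoPair_natDegree a m).2, Finset.sum_range_succ',
      Finset.sum_eq_zero, (szegoPair_coeff_top a m).2]
    · simp
    · intro i hi
      rw [toeplitzForm_X_mul_X_pow_succ, hm1.1 i (by have := Finset.mem_range.1 hi; omega),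
        mul_zero]
  rw [T1, T2, T3, T4, sub_zero] at key
  exact key

end

/-! ### Modified Bessel functions and bounded solutions of their recurrence -/

lemma norm_besselI_term_le (n k : ℕ) (t : ℝ) :
    ‖(t / 2) ^ (2 * k + n) / ((k ! : ℝ) * ((k + n)! : ℝ))‖ ≤
      |t / 2| ^ n / (n ! : ℝ) * (((t / 2) ^ 2) ^ k / (k ! : ℝ)) := by
  rw [Real.norm_eq_abs, abs_div, abs_pow, pow_add, pow_mul, sq_abs,
    abs_of_pos (by positivity : (0 : ℝ) < k ! * (k + n)!), div_mul_div_comm, mul_comm (_ ^ k),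
    mul_comm (k ! : ℝ)]
  gcongr
  omega

lemma besselI_summable (n : ℕ) (t : ℝ) :
    Summable fun k : ℕ => (t / 2) ^ (2 * k + n) / ((k ! : ℝ) * ((k + n)! : ℝ)) :=
  Summable.of_norm_bounded ((Real.summable_pow_div_factorial ((t / 2) ^ 2)).mul_left _)
    fun k => norm_besselI_term_le n k t

lemma besselI_zero_pos (t : ℝ) : 0 < besselI 0 t := by
  refine (besselI_summable 0 t).tsum_pos (fun k => ?_) 0 (by simp)
  rw [add_zero, pow_mul]
  positivity

lemma besselI_recurrence (n : ℕ) (t : ℝ) :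
    ((n : ℝ) + 1) * besselI (n + 1) t = t / 2 * (besselI n t - besselI (n + 2) t) := by
  have h1 := (besselI_summable (n + 1) t).mul_left ((n : ℝ) + 1)
  have h0 := besselI_summable n t
  have h2 := (besselI_summable (n + 2) t).mul_left (t / 2)
  have e0 : besselI n t = _ := h0.tsum_eq_zero_add
  -- The terms of `besselI n` after the first combine with those of `besselI (n + 2)`.
  have key : t / 2 * besselI n t =
      ((n : ℝ) + 1) * besselI (n + 1) t + t / 2 * besselI (n + 2) t := by
    have e1 : ((n : ℝ) + 1) * besselI (n + 1) t = _ := (tsum_mul_left (a := (n : ℝ) + 1)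
      (f := fun k : ℕ => (t / 2) ^ (2 * k + (n + 1)) / ((k ! : ℝ) * ((k + (n + 1))! : ℝ)))).symm
    rw [h1.tsum_eq_zero_add] at e1
    rw [e0, e1, besselI, ← tsum_mul_left, mul_add, ← tsum_mul_left, add_assoc,
      ← ((summable_nat_add_iff 1).2 h1).tsum_add h2]
    congr 1
    · simp only [Nat.factorial_zero, zero_add, mul_zero, Nat.factorial_succ]
      push_cast
      field_simp
      ring
    · refine tsum_congr fun k => ?_
      have f1 : (k + 1 + n)! = (k + n + 1) * (k + n)! := by
        rw [show k + 1 + n = k + n + 1 by ring, Nat.factorial_succ]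
      have f2 : (k + 1 + (n + 1))! = (k + n + 2) * ((k + n + 1) * (k + n)!) := by
        rw [show k + 1 + (n + 1) = k + n + 1 + 1 by ring, Nat.factorial_succ, Nat.factorial_succ]
      have f3 : (k + (n + 2))! = (k + n + 2) * ((k + n + 1) * (k + n)!) := by
        rw [← f2]; congr 1; ring
      have f4 : (k + 1)! = (k + 1) * k ! := Nat.factorial_succ k
      rw [f1, f2, f3, f4]
      push_cast
      have : (k : ℝ) + n + 1 ≠ 0 := by positivity
      have : (k : ℝ) + n + 2 ≠ 0 := by positivity
      have : (k : ℝ) + 1 ≠ 0 := by positivity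
      field_simp
      ring
  linarith

lemma besselI_tendsto_zero (t : ℝ) :
    Filter.Tendsto (fun n => besselI n t) Filter.atTop (nhds 0) := by
  have hs := Real.summable_pow_div_factorial ((t / 2) ^ 2)
  refine squeeze_zero_norm (fun n => tsum_of_norm_bounded
    (hs.hasSum.mul_left (|t / 2| ^ n / (n ! : ℝ))) fun k => norm_besselI_term_le n k t) ?_
  simpa only [zero_mul] using (FloorSemiring.tendsto_pow_div_factorial_atTop |t / 2|).mul_const _

/-- The Wronskian of two solutions of the Bessel recurrence has constant modulus, so a bounded
solution is proportional to one that tends to zero. -/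
lemma bessel_recurrence_wronskian {t : ℝ} (ht : t ≠ 0) {r s : ℕ → ℝ} {M : ℝ}
    (hr : ∀ n : ℕ, ((n : ℝ) + 1) * r (n + 1) = t / 2 * (r n - r (n + 2)))
    (hs : ∀ n : ℕ, ((n : ℝ) + 1) * s (n + 1) = t / 2 * (s n - s (n + 2)))
    (hM : ∀ n, |r n| ≤ M) (hs0 : Filter.Tendsto s Filter.atTop (nhds 0)) :
    r 0 * s 1 = r 1 * s 0 := by
  set w : ℕ → ℝ := fun n => r n * s (n + 1) - r (n + 1) * s n with hw
  have hstep : ∀ n, w (n + 1) = -w n := by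
    intro n
    have : t / 2 * (w (n + 1) + w n) = 0 := by
      simp only [hw]
      linear_combination r (n + 1) * hs n - s (n + 1) * hr n
    rcases mul_eq_zero.1 this with h | h
    · exact absurd h (by simpa using ht)
    · linarith
  have hconst : ∀ n, |w n| = |w 0| := by
    intro n
    induction n with
    | zero => rfl
    | succ n ih => rw [hstep, abs_neg, ih]
  have hlim : Filter.Tendsto w Filter.atTop (nhds 0) := by
    have hz : Filter.Tendsto (fun n => M * |s (n + 1)| + M * |s n|) Filter.atTop (nhds 0) := by
      simpa using (((Filter.tendsto_add_atTop_iff_nat 1).2 hs0).abs.const_mul M).add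
        (hs0.abs.const_mul M)
    refine squeeze_zero_norm (fun n => (norm_sub_le _ _).trans ?_) hz
    rw [norm_mul, norm_mul]
    exact add_le_add (mul_le_mul_of_nonneg_right (hM n) (abs_nonneg _))
      (mul_le_mul_of_nonneg_right (hM (n + 1)) (abs_nonneg _))
  have h0 : |w 0| = 0 := by
    have h := hlim.abs
    simp only [hconst, abs_zero] at h
    exact tendsto_nhds_unique tendsto_const_nhds h
  have := abs_eq_zero.1 h0
  simp only [hw, zero_add] at this
  linarith

/-! ### Discrete Painlevé II -/

/-- The recursion determines a solution from its value at `0`. -/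
lemma IsDPIISolution.eq_of_zero {t : ℝ} {a b : ℤ → ℝ} (ha : IsDPIISolution t a)
    (hb : IsDPIISolution t b) (h0 : b 0 = a 0) : ∀ n : ℤ, -1 ≤ n → b n = a n := by
  have h : ∀ n : ℕ, b n = a n ∧ b (n - 1) = a (n - 1) := by
    intro n
    induction n with
    | zero => exact ⟨by simpa using h0, by simp [ha.1, hb.1]⟩
    | succ n ih =>
      have h1 := (ha.2 n (by positivity)).2
      have h2 := (hb.2 n (by positivity)).2
      rw [ih.1, ih.2, ← h1] at h2
      refine ⟨by push_cast; linarith, by simpa using ih.1⟩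
  intro n hn
  obtain ⟨k, hk⟩ := Int.eq_ofNat_of_zero_le (show 0 ≤ n + 1 by omega)
  have := (h k).2
  rwa [show (k : ℤ) - 1 = n from by omega] at this

/-- The solution on `ℕ` of the Bessel recurrence with values `1`, `x` at `0`, `1`. -/
noncomputable def besselSeq (t x : ℝ) : ℕ → ℝ
  | 0 => 1
  | 1 => x
  | n + 2 => besselSeq t x n - 2 * (n + 1) / t * besselSeq t x (n + 1)

lemma besselSeq_recurrence {t : ℝ} (ht : t ≠ 0) (x : ℝ) (n : ℕ) :
    ((n : ℝ) + 1) * besselSeq t x (n + 1) =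
      t / 2 * (besselSeq t x n - besselSeq t x (n + 2)) := by
  rw [besselSeq]
  field_simp
  ring

/-- The even extension to `ℤ` of a solution on `ℕ` satisfies the recurrence at every integer. -/
lemma even_recurrence {t : ℝ} {r : ℕ → ℝ}
    (hr : ∀ n : ℕ, ((n : ℝ) + 1) * r (n + 1) = t / 2 * (r n - r (n + 2))) (k : ℤ) :
    (k : ℝ) * r k.natAbs = t / 2 * (r (k - 1).natAbs - r (k + 1).natAbs) := by
  obtain ⟨n, rfl | rfl⟩ := k.eq_nat_or_neg
  · cases n with
    | zero => simp
    | succ n =>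
      have := hr n
      rw [show ((n + 1 : ℕ) : ℤ).natAbs = n + 1 by omega,
        show (((n + 1 : ℕ) : ℤ) - 1).natAbs = n by omega,
        show (((n + 1 : ℕ) : ℤ) + 1).natAbs = n + 2 by omega]
      push_cast
      exact this
  · cases n with
    | zero => simp
    | succ n =>
      have := hr n
      rw [show (-((n + 1 : ℕ) : ℤ)).natAbs = n + 1 by omega,
        show (-((n + 1 : ℕ) : ℤ) - 1).natAbs = n + 2 by omega,
        show (-((n + 1 : ℕ) : ℤ) + 1).natAbs = n by omega]
      push_cast
      linarith

section
open Polynomial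

/-- A Toeplitz form with Verblunsky coefficients in `(-1, 1)` is nonnegative, because the orthogonal
polynomials then have positive norms. -/
lemma toeplitzForm_self_nonneg {c : ℤ → ℝ} {a : ℕ → ℝ} (hc : ∀ k, c (-k) = c k) (h0 : 0 < c 0)
    (hv : ∀ k, IsVerblunskyAt c a k) (ha : ∀ k, a k ^ 2 < 1) (p : ℝ[X]) :
    0 ≤ toeplitzForm c p p := by
  have hpos : ∀ n, 0 < toeplitzForm c (szegoPair a n).2 1 := by
    intro n
    induction n with
    | zero => simpa [szegoPair] using (toeplitzForm_X_pow c 0 0).trans_gt (by simpa using h0)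
    | succ n ih =>
      rw [szegoPair_norm_succ (hv n)]
      exact mul_pos (by linarith [ha n]) ih
  suffices H : ∀ n, ∀ p : ℝ[X], p.natDegree < n → 0 ≤ toeplitzForm c p p from
    H _ p (Nat.lt_succ_self _)
  intro n
  induction n with
  | zero => intro p hp; omega
  | succ n ih =>
    intro p hp
    set Φ := (szegoPair a n).1 with hΦ
    -- Subtracting the component along `Φ_n` lowers the degree, as `Φ_n` is monic.
    set x := p.coeff n
    set q := p - x • Φ with hq
    have hdΦ : Φ.natDegree ≤ n := (szegoPair_natDegree a n).1
    have horth := (szegoPair_orthogonal hc (n := n) fun k _ => hv k).1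
    have hqn : q.coeff n = 0 := by
      simp [hq, hΦ, (szegoPair_coeff_top a n).1, x]
    have hqd : q.natDegree ≤ n :=
      (natDegree_sub_le_of_le (Nat.lt_succ_iff.1 hp) ((natDegree_smul_le x Φ).trans hdΦ)).trans
        (max_self _).le
    have hΦq : toeplitzForm c Φ q = 0 := by
      rw [toeplitzForm_eq_coeff_mul horth hqd, hqn, zero_mul]
    have hqq : 0 ≤ toeplitzForm c q q := by
      rcases Nat.eq_zero_or_pos n with rfl | hn
      · have : q = 0 := by
          rw [eq_C_of_natDegree_le_zero hqd, hqn, C_0]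
        simp [this]
      · refine ih q (lt_of_le_of_ne hqd fun he => ?_)
        have : q = 0 := by rw [← leadingCoeff_eq_zero, leadingCoeff, he, hqn]
        rw [this, natDegree_zero] at he
        omega
    have hp' : p = q + x • Φ := by simp [hq]
    have hself := toeplitzForm_szegoPair_self hc fun k (_ : k < n) => hv k
    have : toeplitzForm c p p = toeplitzForm c q q + x ^ 2 * toeplitzForm c Φ Φ := by
      rw [hp']
      simp [hΦq, toeplitzForm_comm hc q Φ]
      ring
    rw [this, hΦ, hself]
    have := hpos n
    positivity

/-- The moments of a Toeplitz form with Verblunsky coefficients in `(-1, 1)` are bounded by the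
zeroth one: the form is nonnegative at `X ^ n ± 1`. -/
lemma abs_moment_le {c : ℤ → ℝ} {a : ℕ → ℝ} (hc : ∀ k, c (-k) = c k) (h0 : 0 < c 0)
    (hv : ∀ k, IsVerblunskyAt c a k) (ha : ∀ k, a k ^ 2 < 1) (n : ℕ) : |c n| ≤ c 0 := by
  have e : ∀ i j : ℕ, toeplitzForm c (X ^ i) (X ^ j) = c ((i : ℤ) - j) := toeplitzForm_X_pow c
  have h1 := toeplitzForm_self_nonneg hc h0 hv ha (X ^ n + X ^ 0)
  have h2 := toeplitzForm_self_nonneg hc h0 hv ha (X ^ n - X ^ 0)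
  simp only [map_add, map_sub, LinearMap.add_apply, LinearMap.sub_apply, e, sub_self,
    Nat.cast_zero, sub_zero, zero_sub, hc] at h1 h2
  rw [abs_le]
  constructor <;> linarith

/-- Every solution of discrete Painlevé II is the Verblunsky sequence of the Toeplitz form whose
moments solve the Bessel recurrence with `c 0 = 1`, `c 1 = b 0`. -/
lemma IsDPIISolution.isVerblunskyAt {t : ℝ} (ht : t ≠ 0) {b : ℤ → ℝ} (hb : IsDPIISolution t b)
    (n : ℕ) : IsVerblunskyAt (fun k => besselSeq t (b 0) k.natAbs) (fun k => b k) n := by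
  set c : ℤ → ℝ := fun k => besselSeq t (b 0) k.natAbs with hcdef
  have hc : ∀ k, c (-k) = c k := fun k => by simp [hcdef]
  have hrec : ∀ k : ℤ, (k : ℝ) * c k = t / 2 * (c (k - 1) - c (k + 1)) :=
    even_recurrence (besselSeq_recurrence ht (b 0))
  induction n using Nat.strong_induction_on with
  | _ n ih =>
    cases n with
    | zero =>
      have e1 := toeplitzForm_X_pow c 1 0
      have e0 := toeplitzForm_X_pow c 0 0
      simp only [pow_one, pow_zero] at e1 e0
      simp only [IsVerblunskyAt, szegoPair, mul_one, e1, e0]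
      simp [hcdef, besselSeq]
    | succ n =>
      have hs := szegoPair_string hc hrec ih
      have hn := szegoPair_norm_succ (ih n n.lt_succ_self)
      have hvn := ih n n.lt_succ_self
      have hcoeff : (szegoPair (fun k : ℕ => b k) n).1.coeff 0 = -b (n - 1) := by
        cases n with
        | zero => simp [szegoPair, hb.1]
        | succ n => rw [szegoPair_coeff_zero_succ]; simp
      obtain ⟨hne, hP⟩ := hb.2 n (by positivity)
      unfold IsVerblunskyAt at hvn ⊢
      rw [hcoeff, hvn] at hs
      have hP' : t * (1 - b n ^ 2) * (b (n + 1) + b (n - 1)) = -2 * ((n : ℝ) + 1) * b n := by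
        rw [hP]
        push_cast
        field_simp
      rw [hn] at hs ⊢
      push_cast at hs ⊢
      have ht2 : t / 2 ≠ 0 := by simpa using ht
      apply mul_left_cancel₀ ht2
      linear_combination hs -
        toeplitzForm c (szegoPair (fun k : ℕ => b k) n).2 1 / 2 * hP'

lemma IsDPIISolution.zero_eq {t : ℝ} (ht : t ≠ 0) {b : ℤ → ℝ} (hb : IsDPIISolution t b)
    (hb1 : ∀ n : ℤ, 0 ≤ n → -1 < b n ∧ b n < 1) : b 0 = besselI 1 t / besselI 0 t := by
  have hM : ∀ n, |besselSeq t (b 0) n| ≤ 1 := fun n => by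
    simpa [besselSeq] using abs_moment_le (c := fun k => besselSeq t (b 0) k.natAbs)
      (fun k => by simp) (by simp [besselSeq]) (fun k => hb.isVerblunskyAt ht k)
      (fun k => (sq_lt_one_iff_abs_lt_one _).2 (abs_lt.2 (hb1 k (by positivity)))) n
  have := bessel_recurrence_wronskian ht (besselSeq_recurrence ht (b 0))
    (fun n => besselI_recurrence n t) hM (besselI_tendsto_zero t)
  rw [eq_div_iff (besselI_zero_pos t).ne']
  simpa [besselSeq] using this.symm

end

/-! ### The weight `e^{t cos θ}` -/

/-- The cosine moment `∫ cos (k θ) e^{t cos θ} dθ` over `[0, 2π]`, not normalized by `2π`. -/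
noncomputable def expCosMoment (t : ℝ) (k : ℤ) : ℝ :=
  ∫ θ in (0 : ℝ)..2 * Real.pi, Real.cos (k * θ) * Real.exp (t * Real.cos θ)

lemma expCosMoment_neg (t : ℝ) (k : ℤ) : expCosMoment t (-k) = expCosMoment t k := by
  simp [expCosMoment]

lemma expCosMoment_zero_pos (t : ℝ) : 0 < expCosMoment t 0 := by
  refine intervalIntegral.intervalIntegral_pos_of_pos ?_ (fun θ => ?_) Real.two_pi_pos
  · exact (by fun_prop : Continuous _).intervalIntegrable _ _
  · simp [Real.exp_pos]

/-- Integration by parts against `sin (k θ)`. -/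
lemma expCosMoment_recurrence (t : ℝ) (k : ℤ) :
    (k : ℝ) * expCosMoment t k =
      t / 2 * (expCosMoment t (k - 1) - expCosMoment t (k + 1)) := by
  have hd : ∀ θ ∈ Set.uIcc 0 (2 * Real.pi),
      HasDerivAt (fun θ => Real.sin (k * θ) * Real.exp (t * Real.cos θ))
        (Real.cos (k * θ) * (k * 1) * Real.exp (t * Real.cos θ) +
          Real.sin (k * θ) * (Real.exp (t * Real.cos θ) * (t * -Real.sin θ))) θ := fun θ _ =>
    (((hasDerivAt_id θ).const_mul (k : ℝ)).sin).mul
      (((Real.hasDerivAt_cos θ).const_mul t).exp)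
  have h := intervalIntegral.integral_eq_sub_of_hasDerivAt hd
    ((by fun_prop : Continuous _).intervalIntegrable _ _)
  have hsin : Real.sin (k * (2 * Real.pi)) = 0 := by
    simpa using Real.sin_add_int_mul_two_pi 0 k
  simp only [hsin, mul_zero, Real.sin_zero, zero_mul, sub_zero] at h
  have hI : ∀ j : ℤ, IntervalIntegrable
      (fun θ => Real.cos (j * θ) * Real.exp (t * Real.cos θ)) MeasureTheory.volume 0
        (2 * Real.pi) := fun j => (by fun_prop : Continuous _).intervalIntegrable _ _
  have e : (k : ℝ) * expCosMoment t k -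
      t / 2 * (expCosMoment t (k - 1) - expCosMoment t (k + 1)) = 0 := by
    rw [← h]
    unfold expCosMoment
    rw [← intervalIntegral.integral_sub (hI _) (hI _), ← intervalIntegral.integral_const_mul,
      ← intervalIntegral.integral_const_mul,
      ← intervalIntegral.integral_sub ((hI _).const_mul _) (((hI _).sub (hI _)).const_mul _)]
    refine intervalIntegral.integral_congr fun θ _ => ?_
    have e1 : Real.cos (((k - 1 : ℤ) : ℝ) * θ) =
        Real.cos (k * θ) * Real.cos θ + Real.sin (k * θ) * Real.sin θ := by
      rw [← Real.cos_sub]; push_cast; ring_nf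
    have e2 : Real.cos (((k + 1 : ℤ) : ℝ) * θ) =
        Real.cos (k * θ) * Real.cos θ - Real.sin (k * θ) * Real.sin θ := by
      rw [← Real.cos_add]; push_cast; ring_nf
    simp only [e1, e2]
    ring
  linarith

lemma abs_expCosMoment_le (t : ℝ) (k : ℤ) : |expCosMoment t k| ≤ expCosMoment t 0 := by
  rw [← Real.norm_eq_abs]
  unfold expCosMoment
  refine intervalIntegral.norm_integral_le_of_norm_le Real.two_pi_pos.le
    (MeasureTheory.ae_of_all _ fun θ _ => ?_)
    ((by fun_prop : Continuous fun θ : ℝ =>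
      Real.cos ((0 : ℤ) * θ) * Real.exp (t * Real.cos θ)).intervalIntegrable _ _)
  rw [norm_mul, Real.norm_eq_abs, Real.norm_eq_abs, Real.abs_exp]
  simpa using mul_le_of_le_one_left (Real.exp_pos _).le (Real.abs_cos_le_one (k * θ))

lemma expCosMoment_one_div_zero {t : ℝ} (ht : t ≠ 0) :
    expCosMoment t 1 / expCosMoment t 0 = besselI 1 t / besselI 0 t := by
  have h := bessel_recurrence_wronskian ht (r := fun n => expCosMoment t n)
    (fun n => by
      have := expCosMoment_recurrence t (n + 1)
      rw [show (n : ℤ) + 1 - 1 = n by ring, show (n : ℤ) + 1 + 1 = n + 2 by ring] at this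
      exact_mod_cast this)
    (fun n => besselI_recurrence n t) (fun n => abs_expCosMoment_le t n) (besselI_tendsto_zero t)
  rw [div_eq_div_iff (expCosMoment_zero_pos t).ne' (besselI_zero_pos t).ne']
  simp only [Nat.cast_zero, Nat.cast_one] at h
  linarith

lemma integral_exp_mul_expCos (t : ℝ) (k : ℤ) :
    ∫ θ in (0 : ℝ)..2 * Real.pi, Complex.exp ((k : ℂ) * θ * Complex.I) *
      (Real.exp (t * Real.cos θ) : ℂ) = (expCosMoment t k : ℂ) := by
  -- The imaginary part vanishes because `θ ↦ 2π - θ` reverses its sign.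
  have hs : ∫ θ in (0 : ℝ)..2 * Real.pi, Real.sin (k * θ) * Real.exp (t * Real.cos θ) = 0 := by
    have h := intervalIntegral.integral_comp_sub_left (a := 0) (b := 2 * Real.pi)
      (fun θ => Real.sin (k * θ) * Real.exp (t * Real.cos θ)) (2 * Real.pi)
    have e : ∀ θ : ℝ, Real.sin (k * (2 * Real.pi - θ)) = -Real.sin (k * θ) := fun θ => by
      rw [show (k : ℝ) * (2 * Real.pi - θ) = k * (2 * Real.pi) - k * θ by ring,
        Real.sin_int_mul_two_pi_sub]
    simp only [e, Real.cos_two_pi_sub, sub_self, sub_zero, neg_mul,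
      intervalIntegral.integral_neg] at h
    linarith
  have hc : ∀ θ : ℝ, Complex.exp ((k : ℂ) * θ * Complex.I) * (Real.exp (t * Real.cos θ) : ℂ) =
      ((Real.cos (k * θ) * Real.exp (t * Real.cos θ) : ℝ) : ℂ) +
        ((Real.sin (k * θ) * Real.exp (t * Real.cos θ) : ℝ) : ℂ) * Complex.I := fun θ => by
    rw [Complex.exp_mul_I]
    push_cast
    ring
  simp only [hc]
  rw [intervalIntegral.integral_add
      ((by fun_prop : Continuous _).intervalIntegrable _ _)
      ((by fun_prop : Continuous _).intervalIntegrable _ _),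
    intervalIntegral.integral_mul_const, intervalIntegral.integral_ofReal,
    intervalIntegral.integral_ofReal, hs]
  simp [expCosMoment]

section
open Polynomial

/-- The Toeplitz form of the cosine moments is the `L²` pairing on the unit circle. -/
lemma integral_map_eval_mul_conj (t : ℝ) (p q : ℝ[X]) :
    ∫ θ in (0 : ℝ)..2 * Real.pi,
        (p.map (algebraMap ℝ ℂ)).eval (Complex.exp (θ * Complex.I)) *
          conj ((q.map (algebraMap ℝ ℂ)).eval (Complex.exp (θ * Complex.I))) *
            ((Real.exp (t * Real.cos θ) : ℝ) : ℂ) =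
      (toeplitzForm (expCosMoment t) p q : ℂ) := by
  have hI : ∀ p q : ℝ[X], IntervalIntegrable (fun θ : ℝ =>
      (p.map (algebraMap ℝ ℂ)).eval (Complex.exp (θ * Complex.I)) *
          conj ((q.map (algebraMap ℝ ℂ)).eval (Complex.exp (θ * Complex.I))) *
            ((Real.exp (t * Real.cos θ) : ℝ) : ℂ)) MeasureTheory.volume 0 (2 * Real.pi) :=
    fun p q => (by fun_prop : Continuous _).intervalIntegrable _ _
  induction p using Polynomial.induction_on' with
  | add p₁ p₂ h₁ h₂ =>
    simp only [Polynomial.map_add, eval_add, map_add, LinearMap.add_apply, Complex.ofReal_add,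
      ← h₁, ← h₂, add_mul]
    exact intervalIntegral.integral_add (hI _ _) (hI _ _)
  | monomial i x =>
    induction q using Polynomial.induction_on' with
    | add q₁ q₂ h₁ h₂ =>
      rw [map_add, Complex.ofReal_add, ← h₁, ← h₂,
        ← intervalIntegral.integral_add (hI _ _) (hI _ _)]
      simp only [Polynomial.map_add, eval_add, map_add, mul_add, add_mul]
    | monomial j y =>
      rw [toeplitzForm_monomial, Complex.ofReal_mul, ← integral_exp_mul_expCos,
        ← intervalIntegral.integral_const_mul]
      refine intervalIntegral.integral_congr fun θ _ => ?_
      have hexp : Complex.exp (((i : ℤ) - (j : ℤ) : ℤ) * θ * Complex.I) =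
          Complex.exp (θ * Complex.I) ^ i * conj (Complex.exp (θ * Complex.I)) ^ j := by
        rw [← Complex.exp_conj, ← Complex.exp_nat_mul, ← Complex.exp_nat_mul, ← Complex.exp_add]
        congr 1
        simp
        ring
      simp only [hexp, map_monomial, eval_monomial, map_mul, map_pow, Complex.coe_algebraMap,
        Complex.conj_ofReal]
      push_cast
      ring

lemma toeplitzForm_expCosMoment_self_pos (t : ℝ) {p : ℝ[X]} (hp : p ≠ 0) :
    0 < toeplitzForm (expCosMoment t) p p := by
  set P : ℂ[X] := p.map (algebraMap ℝ ℂ)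
  have h : toeplitzForm (expCosMoment t) p p = ∫ θ in (0 : ℝ)..2 * Real.pi,
      ‖P.eval (Complex.exp (θ * Complex.I))‖ ^ 2 * Real.exp (t * Real.cos θ) := by
    have h := integral_map_eval_mul_conj t p p
    rw [← Complex.ofReal_inj, ← h, ← intervalIntegral.integral_ofReal]
    refine intervalIntegral.integral_congr fun θ _ => ?_
    simp only [Complex.mul_conj, Complex.normSq_eq_norm_sq]
    push_cast
    rfl
  rw [h]
  refine intervalIntegral.integral_pos Real.two_pi_pos
    (by fun_prop : Continuous _).continuousOn (fun θ _ => by positivity) ?_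
  -- Otherwise `P` vanishes on the whole circle.
  by_contra! hcon
  have hP : P ≠ 0 := (Polynomial.map_ne_zero_iff (algebraMap ℝ ℂ).injective).2 hp
  have hinj : Set.InjOn (fun θ : ℝ => Complex.exp (θ * Complex.I))
      (Set.Ico 0 (2 * Real.pi)) := by
    intro x hx y hy hxy
    obtain ⟨n, hn⟩ := Complex.exp_eq_exp_iff_exists_int.1 hxy
    have hn' : x = y + n * (2 * Real.pi) := by
      have := congrArg Complex.im hn
      simpa using this
    have hn0 : n = 0 := by
      have hpi := Real.two_pi_pos
      have h1 : (n : ℝ) < 1 := by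
        by_contra! hc
        nlinarith [hx.2, hy.1]
      have h2 : (-1 : ℝ) < n := by
        by_contra! hc
        nlinarith [hx.1, hy.2]
      have h1' : n < 1 := by exact_mod_cast h1
      have h2' : -1 < n := by exact_mod_cast h2
      omega
    simpa [hn0] using hn'
  have hinf := (Set.Ico_infinite Real.two_pi_pos).image hinj
  refine hinf (P.roots.toFinset.finite_toSet.subset ?_)
  rintro _ ⟨θ, hθ, rfl⟩
  have h0 := hcon θ (Set.Ico_subset_Icc_self hθ)
  have : ‖P.eval (Complex.exp (θ * Complex.I))‖ ^ 2 = 0 := by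
    have hE := Real.exp_pos (t * Real.cos θ)
    by_contra hne
    have : 0 < ‖P.eval (Complex.exp (θ * Complex.I))‖ ^ 2 := lt_of_le_of_ne (by positivity)
      (Ne.symm hne)
    exact absurd h0 (not_le.2 (mul_pos this hE))
  simpa [hP] using this

/-! ### Existence -/

/-- Gram–Schmidt in Szegő form: the pair `(Φ_n, Φ_n^*)` for the Toeplitz form of `c`, where each
coefficient of Szegő's recursion is read off from the form as `⟨X Φ_n, 1⟩ / ⟨Φ_n^*, 1⟩`. -/
noncomputable def gramSchmidtPair (c : ℤ → ℝ) : ℕ → ℝ[X] × ℝ[X]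
  | 0 => (1, 1)
  | n + 1 =>
    let s := gramSchmidtPair c n
    let x := toeplitzForm c (X * s.1) 1 / toeplitzForm c s.2 1
    (X * s.1 - x • s.2, s.2 - x • (X * s.1))

/-- The Verblunsky coefficients of the Toeplitz form of `c`. -/
noncomputable def verblunskyCoeff (c : ℤ → ℝ) (n : ℕ) : ℝ :=
  toeplitzForm c (X * (gramSchmidtPair c n).1) 1 / toeplitzForm c (gramSchmidtPair c n).2 1

lemma szegoPair_verblunskyCoeff (c : ℤ → ℝ) (n : ℕ) :
    szegoPair (verblunskyCoeff c) n = gramSchmidtPair c n := by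
  induction n with
  | zero => rfl
  | succ n ih => rw [szegoPair, ih]; rfl

lemma isVerblunskyAt_verblunskyCoeff {c : ℤ → ℝ} (hc : ∀ k, c (-k) = c k)
    (hpos : ∀ p : ℝ[X], p ≠ 0 → 0 < toeplitzForm c p p) (n : ℕ) :
    IsVerblunskyAt c (verblunskyCoeff c) n := by
  induction n using Nat.strong_induction_on with
  | _ n ih =>
    have h := hpos _ (szegoPair_monic (verblunskyCoeff c) n).ne_zero
    rw [toeplitzForm_szegoPair_self hc ih, szegoPair_verblunskyCoeff] at h
    unfold IsVerblunskyAt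
    rw [szegoPair_verblunskyCoeff, verblunskyCoeff, div_mul_cancel₀ _ h.ne']

lemma szegoPair_norm_pos {c : ℤ → ℝ} (hc : ∀ k, c (-k) = c k)
    (hpos : ∀ p : ℝ[X], p ≠ 0 → 0 < toeplitzForm c p p) (n : ℕ) :
    0 < toeplitzForm c (szegoPair (verblunskyCoeff c) n).2 1 := by
  rw [← toeplitzForm_szegoPair_self hc fun k _ => isVerblunskyAt_verblunskyCoeff hc hpos k]
  exact hpos _ (szegoPair_monic (verblunskyCoeff c) n).ne_zero

lemma verblunskyCoeff_sq_lt_one {c : ℤ → ℝ} (hc : ∀ k, c (-k) = c k)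
    (hpos : ∀ p : ℝ[X], p ≠ 0 → 0 < toeplitzForm c p p) (n : ℕ) : verblunskyCoeff c n ^ 2 < 1 := by
  have h0 := szegoPair_norm_pos hc hpos n
  have h1 := szegoPair_norm_pos hc hpos (n + 1)
  rw [szegoPair_norm_succ (isVerblunskyAt_verblunskyCoeff hc hpos n)] at h1
  linarith [(mul_pos_iff_of_pos_right h0).1 h1]

lemma verblunskyCoeff_zero (c : ℤ → ℝ) : verblunskyCoeff c 0 = c 1 / c 0 := by
  have e1 := toeplitzForm_X_pow c 1 0
  have e0 := toeplitzForm_X_pow c 0 0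
  simp only [pow_one, pow_zero] at e1 e0
  simp [verblunskyCoeff, gramSchmidtPair, e1, e0]

end

section
open Polynomial

/-- The sequence on `ℤ` with the Verblunsky coefficients of `e^{t cos θ}` at `n ≥ 0` and `-1` at
negative indices. -/
noncomputable def expCosVerblunsky (t : ℝ) : ℤ → ℝ
  | Int.ofNat n => verblunskyCoeff (expCosMoment t) n
  | Int.negSucc _ => -1

lemma expCosVerblunsky_natCast (t : ℝ) (n : ℕ) :
    expCosVerblunsky t n = verblunskyCoeff (expCosMoment t) n := rfl

lemma expCosVerblunsky_bounds (t : ℝ) (n : ℤ) (hn : 0 ≤ n) :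
    -1 < expCosVerblunsky t n ∧ expCosVerblunsky t n < 1 := by
  lift n to ℕ using hn
  rw [expCosVerblunsky_natCast, ← abs_lt, ← sq_lt_one_iff_abs_lt_one]
  exact verblunskyCoeff_sq_lt_one (expCosMoment_neg t)
    (fun _ => toeplitzForm_expCosMoment_self_pos t) n

lemma isDPIISolution_expCosVerblunsky {t : ℝ} (ht : t ≠ 0) :
    IsDPIISolution t (expCosVerblunsky t) := by
  refine ⟨rfl, fun n hn => ?_⟩
  lift n to ℕ using hn
  have hc := expCosMoment_neg t
  have hpos : ∀ p : ℝ[X], p ≠ 0 → 0 < toeplitzForm (expCosMoment t) p p :=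
    fun _ => toeplitzForm_expCosMoment_self_pos t
  have hv := isVerblunskyAt_verblunskyCoeff hc hpos
  have hs := szegoPair_string hc (expCosMoment_recurrence t) (m := n) fun k _ => hv k
  have h1 := hv n
  have h2 := hv (n + 1)
  have hh := szegoPair_norm_pos hc hpos n
  have hlt := verblunskyCoeff_sq_lt_one hc hpos n
  have hcoeff : (szegoPair (verblunskyCoeff (expCosMoment t)) n).1.coeff 0 =
      -expCosVerblunsky t (n - 1) := by
    cases n with
    | zero => simp [szegoPair, show expCosVerblunsky t (-1) = -1 from rfl]
    | succ n =>
      rw [szegoPair_coeff_zero_succ, show ((n + 1 : ℕ) : ℤ) - 1 = n by push_cast; ring]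
      rfl
  unfold IsVerblunskyAt at h1 h2
  rw [h1, h2, szegoPair_norm_succ (hv n), hcoeff] at hs
  rw [show (n : ℤ) + 1 = (n + 1 : ℕ) by push_cast; ring, expCosVerblunsky_natCast,
    expCosVerblunsky_natCast]
  have hne : 1 - verblunskyCoeff (expCosMoment t) n ^ 2 ≠ 0 := by linarith
  refine ⟨hne, ?_⟩
  rw [eq_div_iff (mul_ne_zero ht hne)]
  apply mul_right_cancel₀ hh.ne'
  push_cast
  linear_combination 2 * hs

lemma isVerblunskySequence_expCos (t : ℝ) :
    IsVerblunskySequence (fun θ => Real.exp (t * Real.cos θ))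
      (fun n => ((expCosVerblunsky t n : ℝ) : ℂ)) := by
  set c := expCosMoment t
  have hc : ∀ k, c (-k) = c k := expCosMoment_neg t
  have hpos : ∀ p : ℝ[X], p ≠ 0 → 0 < toeplitzForm c p p :=
    fun _ => toeplitzForm_expCosMoment_self_pos t
  have hv := isVerblunskyAt_verblunskyCoeff hc hpos
  have hlt : ∀ m n, m < n → toeplitzForm c (szegoPair (verblunskyCoeff c) n).1
      (szegoPair (verblunskyCoeff c) m).1 = 0 := fun m n hmn => by
    have hd := (szegoPair_natDegree (verblunskyCoeff c) m).1
    rw [toeplitzForm_eq_coeff_mul (szegoPair_orthogonal hc fun k _ => hv k).1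
      (hd.trans hmn.le), coeff_eq_zero_of_natDegree_lt (by omega), zero_mul]
  refine ⟨fun n => (szegoPair (verblunskyCoeff c) n).1.map (algebraMap ℝ ℂ),
    ⟨fun n => ⟨(szegoPair_monic _ n).map _, ?_⟩,
      fun n => (√(toeplitzForm c (szegoPair (verblunskyCoeff c) n).1
        (szegoPair (verblunskyCoeff c) n).1))⁻¹, fun n => ?_, fun m n => ?_⟩, fun n => ?_⟩
  · rw [natDegree_map, szegoPair_natDegree_eq]
  · exact inv_pos.2 (Real.sqrt_pos.2 (hpos _ (szegoPair_monic _ n).ne_zero))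
  · rw [integral_map_eval_mul_conj]
    split_ifs with h
    · subst h
      rw [← Complex.ofReal_pow, inv_pow,
        Real.sq_sqrt (hpos _ (szegoPair_monic _ m).ne_zero).le]
      simp [c]
    · rw [Complex.ofReal_eq_zero]
      rcases lt_or_gt_of_ne h with h | h
      · exact hlt _ _ h
      · exact (toeplitzForm_comm hc _ _).trans (hlt _ _ h)
  · simp only [expCosVerblunsky_natCast]
    rw [← coeff_zero_eq_eval_zero, coeff_map, szegoPair_coeff_zero_succ]
    simp [c]

end

theorem theorem1 (t : ℝ) (ht : t ≠ 0) :
    besselI 0 t ≠ 0 ∧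
      ∃ a : ℤ → ℝ,
        IsDPIISolution t a ∧
        (∀ n : ℤ, 0 ≤ n → -1 < a n ∧ a n < 1) ∧
        (∀ b : ℤ → ℝ, IsDPIISolution t b → (∀ n : ℤ, 0 ≤ n → -1 < b n ∧ b n < 1) →
          ∀ n : ℤ, -1 ≤ n → b n = a n) ∧
        a 0 = besselI 1 t / besselI 0 t ∧
        (∀ b : ℤ → ℝ, IsDPIISolution t b → b 0 = besselI 1 t / besselI 0 t →
          ∀ n : ℤ, -1 ≤ n → b n = a n) ∧
        IsVerblunskySequence (fun θ : ℝ => Real.exp (t * Real.cos θ))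
          (fun n : ℕ => ((a n : ℝ) : ℂ)) := by
  have ha := isDPIISolution_expCosVerblunsky ht
  have h0 : expCosVerblunsky t 0 = besselI 1 t / besselI 0 t :=
    (verblunskyCoeff_zero (expCosMoment t)).trans (expCosMoment_one_div_zero ht)
  exact ⟨(besselI_zero_pos t).ne', expCosVerblunsky t, ha, expCosVerblunsky_bounds t,
    fun b hb hb1 => ha.eq_of_zero hb ((hb.zero_eq ht hb1).trans h0.symm), h0,
    fun b hb hb0 => ha.eq_of_zero hb (hb0.trans h0.symm), isVerblunskySequence_expCos t⟩
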